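/- A Stable Roommates (SR) instance $I=(A,\succ)$ consists of a finite set $A$ of $n$ agents in which every agent $a_i$ has a strict linear preference ranking $\succ_i$ over all other agents; by convention $a_i$ ranks itself last. A permutation $\Pi$ of $A$ is a stable partition of $I$ if (T1) for every $a_i\in A$, either $\Pi(a_i)=\Pi^{-1}(a_i)$ or $\Pi(a_i)\succ_i\Pi^{-1}(a_i)$, and (T2) there are no two distinct agents $a_i,a_j$ with $a_j\succ_i\Pi^{-1}(a_i)$ and $a_i\succ_j\Pi^{-1}(a_j)$. A stable cycle of $I$ is a cycle in the disjoint cycle decomposition of some stable partition of $I$ (fixed points are counted as cycles of length $1$), and a stable cycle is reduced if its length is $2$ or odd. Let $\mathcal{SC}$ and $\mathcal{RSC}$ be the sets of stable cycles and of reduced stable cycles of $I$. Then, for every SR instance $I$, $$|\mathcal{RSC}|\le|\mathcal{SC}|\le 3\,|\mathcal{RSC}|.$$ Moreover $|\mathcal{SC}|=O(n^2)$: there is an absolute constant $K$ such that $|\mathcal{SC}|\le K n^2$ for every SR instance with $n$ agents. -/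

import Mathlib

universe u

/-- A Stable Roommates instance with set of agents `A`: every agent `i` has a strict linear
preference ranking over all the other agents; `pref i j k` says that `i` ranks `j` strictly
better than `k`. -/
structure SRInstance (A : Type*) where
  pref : ∀ i : A, {j : A // j ≠ i} → {j : A // j ≠ i} → Prop
  strict : ∀ i : A, IsStrictTotalOrder {j : A // j ≠ i} (pref i)

namespace SRInstance

variable {A : Type*}

/-- `I.Prefers i j k`, written `j ≻ᵢ k`: the agent `i` strictly prefers `j` to `k`. The ranking of
`i` over the other agents is extended to all agents by the usual convention that `i` ranks itself
last, so that an agent at a fixed point of a permutation prefers every other agent to its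
predecessor. -/
def Prefers (I : SRInstance A) (i j k : A) : Prop :=
  (∃ (hj : j ≠ i) (hk : k ≠ i), I.pref i ⟨j, hj⟩ ⟨k, hk⟩) ∨ (j ≠ i ∧ k = i)

/-- A permutation `π` of the agents is a stable partition if every agent weakly prefers its
successor to its predecessor, and no two distinct agents strictly prefer each other to their
predecessors. -/
def IsStablePartition (I : SRInstance A) (π : Equiv.Perm A) : Prop :=
  (∀ i, π i = π⁻¹ i ∨ I.Prefers i (π i) (π⁻¹ i)) ∧
    ¬ ∃ i j, i ≠ j ∧ I.Prefers i j (π⁻¹ i) ∧ I.Prefers j i (π⁻¹ j)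

/-- `c` is one of the disjoint cycles of the permutation `π`: a non-empty cyclic sequence of
distinct agents in which `π` maps each agent to the next one. Fixed points of `π` are cycles of
length `1`. -/
def IsCycleIn (c : Cycle A) (π : Equiv.Perm A) : Prop :=
  c ≠ Cycle.nil ∧ c.Nodup ∧ c.Chain (fun a b => π a = b)

/-- A cycle is reduced if its length is `2` or odd. -/
def IsReducedCycle (c : Cycle A) : Prop :=
  c.length = 2 ∨ Odd c.length

/-- The stable cycles of `I`: the cycles of the stable partitions of `I`. -/
def stableCycles (I : SRInstance A) : Set (Cycle A) :=
  {c | ∃ π : Equiv.Perm A, I.IsStablePartition π ∧ IsCycleIn c π}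

/-- The reduced stable cycles of `I`: the stable cycles that are reduced. -/
def reducedStableCycles (I : SRInstance A) : Set (Cycle A) :=
  {c | c ∈ I.stableCycles ∧ IsReducedCycle c}

/-- There are finitely many stable cycles, so `Set.ncard` of this set and of its subsets is the true number of elements. -/
theorem finite_stableCycles [Finite A] (I : SRInstance A) : I.stableCycles.Finite := by
  classical
  have := Fintype.ofFinite A
  have h : {c : Cycle A | c.Nodup}.Finite :=
    Set.finite_coe_iff.mp (Finite.of_fintype {c : Cycle A // c.Nodup})
  exact h.subset fun c ⟨_, _, hc⟩ => hc.2.1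

end SRInstance

namespace SRInstance

variable {A : Type*} {I : SRInstance A} {π ρ : Equiv.Perm A}

/-! A stable cycle of length at least 3 is determined by any one of its arcs
(`IsStablePartition.cycle_eq`): two stable partitions sharing such an arc must share the next one
(`apply_eq_apply`), hence the whole cycle. Cycles of length at most 2 are determined by an arc
trivially, so there are at most `2 * n ^ 2` stable cycles. An even cycle can be cut into alternate
transpositions without losing stability (`exists_split`), so each of its arcs spans a stable 2-cycle
(`pair_mem`). Choosing an arc directed upward in a fixed linear order injects the non-reduced cycles
into the reduced ones. This gives even the factor 2 in place of 3. -/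

theorem inv_apply_apply (π : Equiv.Perm A) (x : A) : π⁻¹ (π x) = x :=
  π.symm_apply_apply x

theorem Prefers.ne_left {i j k : A} (h : I.Prefers i j k) : j ≠ i := by
  rcases h with ⟨hj, _⟩ | ⟨hj, _⟩ <;> exact hj

theorem Prefers.trans {i j k l : A} (h : I.Prefers i j k) (h' : I.Prefers i k l) :
    I.Prefers i j l := by
  have := I.strict i
  rcases h with ⟨hj, hk, h⟩ | ⟨hj, hk⟩
  · rcases h' with ⟨_, hl, h'⟩ | ⟨_, hl⟩
    · exact Or.inl ⟨hj, hl, _root_.trans h h'⟩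
    · exact Or.inr ⟨hj, hl⟩
  · exact absurd hk h'.ne_left

theorem Prefers.ne {i j k : A} (h : I.Prefers i j k) : j ≠ k := by
  have := I.strict i
  rintro rfl
  rcases h with ⟨_, _, h⟩ | ⟨h, h'⟩
  · exact irrefl_of (I.pref i) _ h
  · exact h h'

theorem Prefers.asymm {i j k : A} (h : I.Prefers i j k) : ¬ I.Prefers i k j :=
  fun h' => (h.trans h').ne rfl

theorem prefers_or_prefers {j k : A} (I : SRInstance A) (i : A) (h : j ≠ k) :
    I.Prefers i j k ∨ I.Prefers i k j := by
  have := I.strict i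
  by_cases hj : j = i
  · exact Or.inr (Or.inr ⟨fun hk => h (hj.trans hk.symm), hj⟩)
  by_cases hk : k = i
  · exact Or.inl (Or.inr ⟨hj, hk⟩)
  rcases trichotomous_of (I.pref i) ⟨j, hj⟩ ⟨k, hk⟩ with h' | h' | h'
  · exact Or.inl (Or.inl ⟨hj, hk, h'⟩)
  · exact absurd (congrArg Subtype.val h') h
  · exact Or.inr (Or.inl ⟨hk, hj, h'⟩)

/-! ### Comparing and modifying stable partitions -/

/-- If `i` strictly prefers `j` to its predecessor, then `j` weakly prefers its own predecessor
to `i`. -/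
theorem IsStablePartition.eq_or_prefers (hπ : I.IsStablePartition π) {i j : A}
    (h : I.Prefers i j (π⁻¹ i)) : π⁻¹ j = i ∨ I.Prefers j (π⁻¹ j) i := by
  by_contra! hc
  exact hπ.2 ⟨i, j, h.ne_left.symm, h, (I.prefers_or_prefers j hc.1).resolve_left hc.2⟩

/-- The set of agents that prefer their predecessor in `π` to their predecessor in `ρ` is closed
under `ρ * π⁻¹`. -/
theorem IsStablePartition.prefers_apply_inv (hπ : I.IsStablePartition π)
    (hρ : I.IsStablePartition ρ) {x : A} (hx : I.Prefers x (π⁻¹ x) (ρ⁻¹ x)) :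
    I.Prefers (ρ (π⁻¹ x)) (π⁻¹ (ρ (π⁻¹ x))) (ρ⁻¹ (ρ (π⁻¹ x))) := by
  obtain ⟨d, rfl⟩ := π.surjective x
  simp only [inv_apply_apply] at hx ⊢
  have hne : ρ d ≠ π d := fun h => hx.ne (by rw [← h, inv_apply_apply])
  -- Stability of `ρ` puts `ρ⁻¹ d` weakly above `π d` for `d`, and `ρ d` is weakly above `ρ⁻¹ d`.
  have h₁ : I.Prefers d (ρ d) (π d) := by
    rcases hρ.eq_or_prefers hx with h | h <;> rcases hρ.1 d with h' | h'
    · exact absurd (h'.trans h) hne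
    · exact h ▸ h'
    · exact h' ▸ h
    · exact h'.trans h
  have h₂ : I.Prefers d (ρ d) (π⁻¹ d) := by
    rcases hπ.1 d with h | h
    · exact h ▸ h₁
    · exact h₁.trans h
  rcases hπ.eq_or_prefers h₂ with h | h
  · exact absurd (Equiv.Perm.inv_eq_iff_eq.1 h) hne
  · exact h

/-- As `A` is finite, that set is also closed under the inverse `π * ρ⁻¹`. -/
theorem IsStablePartition.prefers_apply_inv' [Finite A] (hπ : I.IsStablePartition π)
    (hρ : I.IsStablePartition ρ) {x : A} (hx : I.Prefers x (π⁻¹ x) (ρ⁻¹ x)) :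
    I.Prefers (π (ρ⁻¹ x)) (π⁻¹ (π (ρ⁻¹ x))) (ρ⁻¹ (π (ρ⁻¹ x))) := by
  have h : Set.MapsTo (ρ * π⁻¹) {x | I.Prefers x (π⁻¹ x) (ρ⁻¹ x)}
      {x | I.Prefers x (π⁻¹ x) (ρ⁻¹ x)} := fun x hx => hπ.prefers_apply_inv hρ hx
  obtain ⟨⟨y, hy⟩, hyx⟩ := Finite.surjective_of_injective
    (h.restrict_inj.2 (ρ * π⁻¹).injective.injOn) ⟨x, hx⟩
  have hyx : ρ (π⁻¹ y) = x := congrArg Subtype.val hyx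
  have hxy : π (ρ⁻¹ x) = y := by
    rw [← hyx, inv_apply_apply]
    exact π.apply_symm_apply y
  rw [hxy]
  exact hy

/-- A common arc of two stable partitions that lies on a `2`-cycle of neither of them extends to a
common path of length `2`. -/
theorem IsStablePartition.apply_eq_apply [Finite A] (hπ : I.IsStablePartition π)
    (hρ : I.IsStablePartition ρ) {a b : A} (ha : π a = b) (ha' : ρ a = b) (hb : π b ≠ a)
    (hb' : ρ b ≠ a) : π b = ρ b := by
  by_contra hne
  have key : ∀ {π ρ : Equiv.Perm A}, I.IsStablePartition π → I.IsStablePartition ρ → π a = b →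
      ρ a = b → ρ b ≠ a → π b ≠ ρ b →
      I.Prefers (ρ b) (π⁻¹ (ρ b)) (ρ⁻¹ (ρ b)) := by
    intro π ρ hπ hρ ha ha' hb' hne
    have hp : π⁻¹ b = a := Equiv.Perm.inv_eq_iff_eq.2 ha.symm
    have hp' : ρ⁻¹ b = a := Equiv.Perm.inv_eq_iff_eq.2 ha'.symm
    have h : I.Prefers b (ρ b) (π⁻¹ b) := by
      have := (hρ.1 b).resolve_left (by rwa [hp'])
      rwa [hp, ← hp']
    rw [inv_apply_apply]
    exact (hπ.eq_or_prefers h).resolve_left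
      fun h => hne (Equiv.Perm.inv_eq_iff_eq.1 h).symm
  -- `π * ρ⁻¹` sends `ρ b` to `π b`, so `π b` prefers its `π`-predecessor, whereas `key` with the
  -- roles exchanged says the opposite.
  have h := hπ.prefers_apply_inv' hρ (key hπ hρ ha ha' hb' hne)
  rw [inv_apply_apply] at h
  exact h.asymm (key hρ hπ ha' ha hb (Ne.symm hne))

/-- If a stable partition `π` exchanges two disjoint sets `S` and `T`, then replacing its cycles
through `S ∪ T` by the transpositions `(x, π x)` for `x ∈ S` gives a stable partition. -/
theorem IsStablePartition.exists_split {S T : Set A} (hπ : I.IsStablePartition π)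
    (hST : Disjoint S T) (hS : ∀ x, π x ∈ T ↔ x ∈ S) (hT : ∀ x, π x ∈ S ↔ x ∈ T) :
    ∃ ρ : Equiv.Perm A, I.IsStablePartition ρ ∧ (∀ x ∈ S, ρ x = π x) ∧ ∀ x ∈ T, ρ x = π⁻¹ x := by
  classical
  have hST' : ∀ x ∈ S, x ∉ T := fun x hx hx' => Set.disjoint_left.1 hST hx hx'
  have hinv : ∀ x, π (π⁻¹ x) = x := π.apply_symm_apply
  have hS' : ∀ x, π⁻¹ x ∈ S ↔ x ∈ T := fun x => by rw [← hS, hinv]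
  have hT' : ∀ x, π⁻¹ x ∈ T ↔ x ∈ S := fun x => by rw [← hT, hinv]
  have hdef : ∃ ρ : Equiv.Perm A, (∀ x, ρ x = if x ∈ T then π⁻¹ x else π x) ∧
      ∀ x, ρ⁻¹ x = if x ∈ S then π x else π⁻¹ x :=
    ⟨⟨fun x => if x ∈ T then π⁻¹ x else π x, fun x => if x ∈ S then π x else π⁻¹ x,
      fun x => by
        by_cases hx : x ∈ T
        · simp only [hx, if_true, (hS' x).2 hx, hinv]
        · simp only [hx, if_false, hT, inv_apply_apply],
      fun x => by
        by_cases hx : x ∈ S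
        · simp only [hx, if_true, (hS x).2 hx, inv_apply_apply]
        · simp only [hx, if_false, hT', hinv]⟩, fun _ => rfl, fun _ => rfl⟩
  obtain ⟨ρ, h, h'⟩ := hdef
  refine ⟨ρ, ⟨fun i => ?_, ?_⟩, fun x hx => by simp [h, hST' x hx], fun x hx => by simp [h, hx]⟩
  · rw [h, h']
    by_cases hiT : i ∈ T
    · rw [if_pos hiT, if_neg fun hi => hST' i hi hiT]
      exact Or.inl rfl
    · by_cases hiS : i ∈ S
      · simp [hiS, hiT]
      · simpa only [hiS, hiT, if_false] using hπ.1 i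
  -- No agent has a worse predecessor in `ρ` than in `π`, so a pair blocking `ρ` would block `π`.
  · have key : ∀ i j, I.Prefers i j (ρ⁻¹ i) → I.Prefers i j (π⁻¹ i) := fun i j hij => by
      rw [h'] at hij
      by_cases hiS : i ∈ S
      · rw [if_pos hiS] at hij
        rcases hπ.1 i with h | h
        · rwa [← h]
        · exact hij.trans h
      · rwa [if_neg hiS] at hij
    rintro ⟨i, j, hne, hij, hji⟩
    exact hπ.2 ⟨i, j, hne, key i j hij, key j i hji⟩

/-! ### Cycles of a permutation -/

theorem exists_eq_coe_cons {c : Cycle A} {a : A} (ha : a ∈ c) : ∃ l : List A, c = ↑(a :: l) := by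
  induction c using Quotient.inductionOn' with | _ l
  obtain ⟨s, t, rfl⟩ := List.append_of_mem (show a ∈ l from ha)
  exact ⟨t ++ s, Cycle.coe_eq_coe.2 ⟨s.length, by simp [List.rotate_append_length_eq]⟩⟩

variable {c d : Cycle A}

theorem IsCycleIn.exists_mem (hc : IsCycleIn c π) : ∃ a, a ∈ c := by
  induction c using Quotient.inductionOn' with | _ l
  cases l with
  | nil => exact absurd rfl hc.1
  | cons a l => exact ⟨a, List.mem_cons_self⟩

theorem IsCycleIn.eq_singleton_or (hc : IsCycleIn c π) {a : A} (ha : a ∈ c) :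
    (c = ↑[a] ∧ π a = a) ∨ (π a ≠ a ∧ ∃ l : List A, c = ↑(a :: π a :: l)) := by
  obtain ⟨l, rfl⟩ := exists_eq_coe_cons ha
  have hch := (Cycle.chain_coe_cons _ _ _).1 hc.2.2
  have hnd := Cycle.nodup_coe_iff.1 hc.2.1
  cases l with
  | nil => exact Or.inl ⟨rfl, by simpa using hch⟩
  | cons b l =>
    have h : π a = b := by
      simp at hch
      exact hch.1
    refine Or.inr ⟨?_, l, by rw [h]⟩
    rintro h'
    rw [h] at h'
    simp [h'] at hnd

theorem IsCycleIn.formPerm_apply [DecidableEq A] (hc : IsCycleIn c π) {a : A} (ha : a ∈ c) :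
    c.formPerm hc.2.1 a = π a := by
  rcases hc.eq_singleton_or ha with ⟨rfl, h⟩ | ⟨_, l, h⟩
  · rw [Cycle.formPerm_subsingleton _ (Cycle.length_subsingleton_iff.2 le_rfl), h]
    rfl
  · have hnd := hc.2.1
    subst_vars
    exact List.formPerm_apply_head _ _ _ (Cycle.nodup_coe_iff.1 hnd)

theorem IsCycleIn.apply_mem (hc : IsCycleIn c π) {a : A} (ha : a ∈ c) : π a ∈ c := by
  rcases hc.eq_singleton_or ha with ⟨_, h⟩ | ⟨_, l, h⟩
  · rwa [h]
  · rw [h]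
    exact List.mem_cons_of_mem _ List.mem_cons_self

/-- Agreement propagates along the cycle from one arc to the next, so both cycles have the same
`formPerm`; `hne` rules out cycles of length 1, which all have trivial `formPerm`. -/
theorem IsCycleIn.eq_of_apply_eq_apply [Finite A] (hc : IsCycleIn c π) (hd : IsCycleIn d ρ)
    (hπρ : ∀ a ∈ c, a ∈ d → π a = ρ a → π (π a) = ρ (π a)) {a : A} (hac : a ∈ c) (had : a ∈ d)
    (ha : π a = ρ a) (hne : π a ≠ a) : c = d := by
  classical
  have aux : ∀ {c d : Cycle A} {π ρ : Equiv.Perm A} (hc : IsCycleIn c π) (hd : IsCycleIn d ρ),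
      (∀ a ∈ c, a ∈ d → π a = ρ a → π (π a) = ρ (π a)) → a ∈ c → a ∈ d → π a = ρ a → π a ≠ a →
      ∀ x ∈ c, x ∈ d ∧ π x = ρ x := by
    intro c d π ρ hc hd hπρ hac had ha hne x hx
    have hcyc := Cycle.isCycle_formPerm c hc.2.1 ⟨a, π a, hne.symm, hac, hc.apply_mem hac⟩
    have hca : c.formPerm hc.2.1 a ≠ a := by rwa [hc.formPerm_apply hac]
    have hxx : c.formPerm hc.2.1 x ≠ x := by
      rw [hc.formPerm_apply hx]
      rcases hc.eq_singleton_or hx with ⟨h, h'⟩ | ⟨h, -⟩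
      · rw [h, Cycle.mem_coe_iff, List.mem_singleton] at hac
        exact absurd (hac ▸ h') hne
      · exact h
    obtain ⟨n, rfl⟩ := hcyc.exists_pow_eq hca hxx
    clear hx hxx
    suffices h : (c.formPerm hc.2.1 ^ n) a ∈ c ∧ (c.formPerm hc.2.1 ^ n) a ∈ d ∧
        π ((c.formPerm hc.2.1 ^ n) a) = ρ ((c.formPerm hc.2.1 ^ n) a) from h.2
    induction n with
    | zero => exact ⟨hac, had, ha⟩
    | succ n ih =>
      rw [pow_succ', Equiv.Perm.mul_apply, hc.formPerm_apply ih.1]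
      refine ⟨hc.apply_mem ih.1, ?_, ?_⟩
      · rw [ih.2.2]
        exact hd.apply_mem ih.2.1
      · rw [hπρ _ ih.1 ih.2.1 ih.2.2, ih.2.2]
  have hcd := aux hc hd hπρ hac had ha hne
  have hdc := aux hd hc (fun x hxd hxc hx => by
    have h := hπρ x hxc hxd hx.symm
    rw [← hx] at h
    exact h.symm)
    had hac ha.symm (ha ▸ hne)
  have hform : c.formPerm hc.2.1 = d.formPerm hd.2.1 := by
    ext x
    by_cases hx : x ∈ c
    · rw [hc.formPerm_apply hx, hd.formPerm_apply (hcd x hx).1, (hcd x hx).2]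
    · rw [Cycle.formPerm_eq_self_of_notMem _ _ _ hx,
        Cycle.formPerm_eq_self_of_notMem _ _ _ fun hx' => hx (hdc x hx').1]
  refine (Cycle.formPerm_eq_formPerm_iff.1 hform).resolve_right fun h => ?_
  have h' : c.length ≤ 1 := h.1
  have := Cycle.length_nontrivial (s := c) ⟨a, π a, hne.symm, hac, hc.apply_mem hac⟩
  omega

theorem IsCycleIn.apply_apply_ne (hc : IsCycleIn c π) (hl : 3 ≤ c.length) {a : A} (ha : a ∈ c) :
    π a ≠ a ∧ π (π a) ≠ a := by
  rcases hc.eq_singleton_or ha with ⟨rfl, h⟩ | ⟨h, l, hcl⟩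
  · simp at hl
  refine ⟨h, fun h' => ?_⟩
  generalize hb : π a = b at *
  subst hcl
  have hch := (Cycle.chain_coe_cons _ _ _).1 hc.2.2
  have hnd := Cycle.nodup_coe_iff.1 hc.2.1
  cases l with
  | nil => simp at hl
  | cons x l =>
    simp at hch
    rw [h'] at hch
    simp [← hch.2.1] at hnd

/-! ### Arcs of stable cycles -/

/-- An arc determines a stable cycle of length at least `3`. -/
theorem IsStablePartition.cycle_eq [Finite A] (hπ : I.IsStablePartition π)
    (hρ : I.IsStablePartition ρ) (hc : IsCycleIn c π) (hd : IsCycleIn d ρ) (hcl : 3 ≤ c.length)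
    (hdl : 3 ≤ d.length) {a : A} (hac : a ∈ c) (had : a ∈ d) (ha : π a = ρ a) : c = d := by
  refine hc.eq_of_apply_eq_apply hd (fun x hxc hxd hx => ?_) hac had ha
    (hc.apply_apply_ne hcl hac).1
  refine hπ.apply_eq_apply hρ rfl hx.symm (hc.apply_apply_ne hcl hxc).2 ?_
  rw [hx]
  exact (hd.apply_apply_ne hdl hxd).2

theorem IsCycleIn.eq_of_length_le_two (hc : IsCycleIn c π) (hd : IsCycleIn d ρ)
    (hcl : c.length ≤ 2) (hdl : d.length ≤ 2) {a : A} (hac : a ∈ c) (had : a ∈ d)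
    (ha : π a = ρ a) : c = d := by
  rcases hc.eq_singleton_or hac with ⟨rfl, h⟩ | ⟨h, l, rfl⟩ <;>
    rcases hd.eq_singleton_or had with ⟨rfl, h'⟩ | ⟨h', l', rfl⟩
  · rfl
  · exact absurd (ha.symm.trans h) h'
  · exact absurd (ha.trans h') h
  · cases l with
    | nil => cases l' with
      | nil => rw [ha]
      | cons x l => simp at hdl
    | cons x l => simp at hcl

/-- The arcs of a stable cycle of even length span stable cycles of length `2`. -/
theorem IsStablePartition.pair_mem [Fintype A] (hπ : I.IsStablePartition π)
    (hc : IsCycleIn c π) (he : Even c.length) {a : A} (ha : a ∈ c) :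
    (↑[a, π a] : Cycle A) ∈ I.reducedStableCycles := by
  classical
  rcases hc.eq_singleton_or ha with ⟨rfl, _⟩ | ⟨hne, -⟩
  · exact absurd he (Nat.not_even_iff_odd.2 odd_one)
  set f := c.formPerm hc.2.1 with hf
  have hnt : c.Nontrivial := ⟨a, π a, hne.symm, ha, hc.apply_mem ha⟩
  have hcyc : f.IsCycle := Cycle.isCycle_formPerm c hc.2.1 hnt
  have hsupp : f.support = c.toFinset := Cycle.support_formPerm c hc.2.1 hnt
  have hfa : f a ≠ a := by rwa [hf, hc.formPerm_apply ha]
  have hcard : orderOf f = c.length := by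
    rw [hcyc.orderOf, hsupp]
    have hnd := hc.2.1
    clear_value f
    clear hsupp
    induction c using Quotient.inductionOn' with | _ l
    exact List.toFinset_card_of_nodup hnd
  have hmem : ∀ k : ℤ, (f ^ k) a ∈ c := fun k => by
    by_contra h
    have h' := Cycle.formPerm_eq_self_of_notMem c hc.2.1 _ h
    rw [← hf, ← Equiv.Perm.mul_apply, ← zpow_one_add, add_comm, zpow_add_one,
      Equiv.Perm.mul_apply] at h'
    exact hfa ((f ^ k).injective h')
  have hstep : ∀ k : ℤ, π ((f ^ k) a) = (f ^ (k + 1)) a := fun k => by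
    rw [← hc.formPerm_apply (hmem k), ← hf, add_comm, zpow_one_add, Equiv.Perm.mul_apply]
  -- The order of `f` is even, so the parity of a position on the cycle is well defined; the even
  -- and odd positions are the two sets exchanged by `π`.
  have hodd : ∀ k : ℤ, (f ^ k) a = a → Even k := fun k hk => by
    have h1 : f ^ k = 1 := by
      ext y
      by_cases hy : f y = y
      · rw [Equiv.Perm.zpow_apply_eq_self_of_apply_eq_self hy, Equiv.Perm.one_apply]
      · obtain ⟨j, rfl⟩ := hcyc.exists_zpow_eq hfa hy
        rw [← Equiv.Perm.mul_apply, ← zpow_add, add_comm, zpow_add, Equiv.Perm.mul_apply, hk,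
          Equiv.Perm.one_apply]
    rw [← orderOf_dvd_iff_zpow_eq_one, hcard] at h1
    exact even_iff_two_dvd.2 ((Int.natCast_dvd_natCast.2 (even_iff_two_dvd.1 he)).trans h1)
  obtain ⟨ρ, hρ, h₁, h₂⟩ := hπ.exists_split (S := {x | ∃ k : ℤ, Even k ∧ x = (f ^ k) a})
    (T := {x | ∃ k : ℤ, Odd k ∧ x = (f ^ k) a})
    (Set.disjoint_left.2 fun x ⟨k, hk, hx⟩ ⟨l, hl, hx'⟩ => by
      have : Even (-l + k) := hodd _ (by
        rw [zpow_add, Equiv.Perm.mul_apply, ← hx, hx', ← Equiv.Perm.mul_apply, ← zpow_add,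
          neg_add_cancel, zpow_zero, Equiv.Perm.one_apply])
      grind)
    (fun x => ⟨fun ⟨k, hk, hx⟩ => ⟨k - 1, by grind, π.injective (by rw [hx, hstep, sub_add_cancel])⟩,
      fun ⟨k, hk, hx⟩ => ⟨k + 1, by grind, by rw [hx, hstep]⟩⟩)
    (fun x => ⟨fun ⟨k, hk, hx⟩ => ⟨k - 1, by grind, π.injective (by rw [hx, hstep, sub_add_cancel])⟩,
      fun ⟨k, hk, hx⟩ => ⟨k + 1, by grind, by rw [hx, hstep]⟩⟩)
  refine ⟨⟨ρ, hρ, by simp, by simpa using hne.symm, ?_⟩, Or.inl rfl⟩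
  have h₁ := h₁ a ⟨0, by simp⟩
  have h₂ := h₂ (π a) ⟨1, by simp, by simpa using hstep 0⟩
  rw [inv_apply_apply] at h₂
  rw [Cycle.chain_coe_cons]
  simp [h₁, h₂]

/-! ### Counting -/

theorem stableCycles_eq_empty [IsEmpty A] (I : SRInstance A) : I.stableCycles = ∅ :=
  Set.eq_empty_of_forall_notMem fun _ ⟨_, _, hc⟩ => isEmptyElim hc.exists_mem.choose

theorem ncard_stableCycles_le [Fintype A] (I : SRInstance A) :
    I.stableCycles.ncard ≤ 2 * Fintype.card A ^ 2 := by
  cases isEmpty_or_nonempty A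
  · simp [I.stableCycles_eq_empty]
  have hex : ∀ c : Cycle A, c ∈ I.stableCycles →
      ∃ e : A × A, ∃ π, I.IsStablePartition π ∧ IsCycleIn c π ∧ e.1 ∈ c ∧ e.2 = π e.1 := by
    rintro c ⟨π, hπ, hc⟩
    obtain ⟨a, ha⟩ := hc.exists_mem
    exact ⟨(a, π a), π, hπ, hc, ha, rfl⟩
  choose! e π hπ hc hmem he using hex
  have hcard : ∀ s : Set (Cycle A), s ⊆ I.stableCycles → Set.InjOn e s →
      s.ncard ≤ Fintype.card A ^ 2 := fun s _ hinj => by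
    refine (Set.ncard_le_ncard_of_injOn e (t := Set.univ) (fun _ _ => trivial) hinj).trans ?_
    rw [Set.ncard_univ, Nat.card_eq_fintype_card, Fintype.card_prod, sq]
  -- A 2-cycle and a longer cycle may share an arc, so arcs are injective only on each class
  -- separately.
  have hunion : I.stableCycles = {c ∈ I.stableCycles | c.length ≤ 2} ∪
      {c ∈ I.stableCycles | 3 ≤ c.length} := by
    ext c
    have : c.length ≤ 2 ∨ 3 ≤ c.length := by omega
    simp only [Set.mem_union, Set.mem_ofPred_eq]
    tauto
  rw [hunion, two_mul]
  refine (Set.ncard_union_le _ _).trans (Nat.add_le_add ?_ ?_)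
  · refine hcard _ (fun _ h => h.1) fun c h d h' heq => ?_
    exact (hc c h.1).eq_of_length_le_two (hc d h'.1) h.2 h'.2 (hmem c h.1)
      (heq ▸ hmem d h'.1) (by rw [← he c h.1, heq, he d h'.1])
  · refine hcard _ (fun _ h => h.1) fun c h d h' heq => ?_
    exact (hπ c h.1).cycle_eq (hπ d h'.1) (hc c h.1) (hc d h'.1) h.2 h'.2 (hmem c h.1)
      (heq ▸ hmem d h'.1) (by rw [← he c h.1, heq, he d h'.1])

theorem ncard_not_reduced_le [Fintype A] (I : SRInstance A) :
    {c ∈ I.stableCycles | ¬ IsReducedCycle c}.ncard ≤ I.reducedStableCycles.ncard := by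
  classical
  cases isEmpty_or_nonempty A
  · simp [I.stableCycles_eq_empty]
  let _ : LinearOrder A := linearOrderOfSTO WellOrderingRel
  have hex : ∀ c : Cycle A, c ∈ {c ∈ I.stableCycles | ¬ IsReducedCycle c} →
      ∃ a b, a < b ∧ ∃ π, I.IsStablePartition π ∧ IsCycleIn c π ∧ a ∈ c ∧ b = π a := by
    rintro c ⟨⟨π, hπ, hc⟩, hr⟩
    -- Starting at the least agent makes the arc point upward, so the unordered pair recovers its
    -- direction.
    obtain ⟨a, ha, hmin⟩ := Set.exists_min_image {a | a ∈ c} id (Set.toFinite _) hc.exists_mem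
    refine ⟨a, π a, lt_of_le_of_ne (hmin _ (hc.apply_mem ha)) fun h => hr ?_, π, hπ, hc, ha, rfl⟩
    rcases hc.eq_singleton_or ha with ⟨rfl, _⟩ | ⟨h', _⟩
    · exact Or.inr odd_one
    · exact absurd h.symm h'
  have hlen : ∀ c : Cycle A, c ∈ {c ∈ I.stableCycles | ¬ IsReducedCycle c} →
      Even c.length ∧ 3 ≤ c.length := by
    rintro c ⟨⟨π, hπ, hc⟩, hr⟩
    have h₁ : Even c.length := Nat.not_odd_iff_even.1 fun h => hr (Or.inr h)
    have h₂ : c.length ≠ 2 := fun h => hr (Or.inl h)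
    have h₃ : c.length ≠ 0 := fun h => by
      obtain ⟨a, ha⟩ := hc.exists_mem
      obtain ⟨l, rfl⟩ := exists_eq_coe_cons ha
      simp at h
    refine ⟨h₁, ?_⟩
    obtain ⟨k, hk⟩ := h₁
    omega
  choose! a b hab π hπ hc hmem he using hex
  refine Set.ncard_le_ncard_of_injOn (fun c => (↑[a c, b c] : Cycle A)) (fun c h => ?_)
    (fun c h d h' heq => ?_) (I.finite_stableCycles.subset fun _ h => h.1)
  · rw [he c h]
    exact (hπ c h).pair_mem (hc c h) (hlen c h).1 (hmem c h)
  · have hrot : a c = a d ∧ b c = b d := by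
      have := Cycle.coe_eq_coe.1 heq
      have hlt := hab c h
      have hlt' := hab d h'
      have h₁ : a c ∈ [a d, b d] := this.mem_iff.1 (by simp)
      have h₂ : b c ∈ [a d, b d] := this.mem_iff.1 (by simp)
      simp only [List.mem_cons, List.not_mem_nil, or_false] at h₁ h₂
      grind
    exact (hπ c h).cycle_eq (hπ d h') (hc c h) (hc d h') (hlen c h).2 (hlen d h').2 (hmem c h)
      (hrot.1 ▸ hmem d h') (by rw [← he c h, hrot.1, hrot.2, he d h'])

end SRInstance

theorem mainTheorem3 :
    (∀ (A : Type u) [Fintype A] (I : SRInstance A),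
      I.reducedStableCycles.ncard ≤ I.stableCycles.ncard ∧
        I.stableCycles.ncard ≤ 3 * I.reducedStableCycles.ncard) ∧
    ∃ K : ℕ, ∀ (A : Type u) [Fintype A] (I : SRInstance A),
      I.stableCycles.ncard ≤ K * Fintype.card A ^ 2 := by
  refine ⟨fun A _ I => ⟨Set.ncard_le_ncard (fun _ h => h.1) I.finite_stableCycles, ?_⟩,
    2, fun A _ I => I.ncard_stableCycles_le⟩
  have h : I.stableCycles = I.reducedStableCycles ∪
      {c ∈ I.stableCycles | ¬ SRInstance.IsReducedCycle c} := by
    ext c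
    simp only [SRInstance.reducedStableCycles, Set.mem_union, Set.mem_ofPred_eq]
    tauto
  have h₁ := Set.ncard_union_le I.reducedStableCycles
    {c ∈ I.stableCycles | ¬ SRInstance.IsReducedCycle c}
  rw [← h] at h₁
  have h₂ := I.ncard_not_reduced_le
  omega
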